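/- Let $K \ge 2$, let $T$ be the horizon, and let $T_1,\dots,T_K$ be integers with $1 \le T_k \le T$. Let $\mathcal E_3(T_1,\dots,T_K)$ be the class of $K$-armed bandit instances in which pulling arm $k$ at epoch $t$ yields a Gaussian reward with variance $1$ and mean $\mu_{k,t}\in[0,1]$, independent of the past given the arm pulled, and in which, for every $k$, the sequence $t\mapsto\mu_{k,t}$ is periodic with minimum period $T_k$. A policy $\pi$ chooses (possibly at random) the arm $\pi_t$ at each epoch $t$ on the basis of the arms pulled and the rewards observed before $t$; it may depend on $K$, $T$ and $T_1,\dots,T_K$. Its expected regret on the instance $\nu$ is $$\mathbb E_\nu[R_T^\pi]=\mathbb E_\nu\Big[\sum_{t=1}^T\Big(\max_{k}\mu_{k,t}-\mu_{\pi_t,t}\Big)\Big].$$ Then every policy $\pi$ satisfies $$\sup_{\nu\in\mathcal E_3(T_1,\dots,T_K)}\mathbb E_\nu[R_T^\pi]\ \ge\ \frac{1}{32e}\sqrt{T\max_{k}T_k}.$$ In particular, the left-hand side is at least $\frac{1}{32e}\cdot\frac{1}{\sqrt K}\sqrt{T\sum_{k=1}^K T_k}$, so that the rate $\sqrt{T\sum_{k}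 T_k}$ cannot be improved by more than a factor of order $\sqrt K$. -/

import Mathlib

open MeasureTheory ProbabilityTheory

noncomputable section

namespace PeriodicBandit

/-- A `K`-armed unit-variance Gaussian bandit instance is given by its mean rewards: `μ k t` is
the mean reward of arm `k` at epoch `t`. Epochs are numbered from `0`, so that a horizon of
length `T` consists of the epochs `0, …, T - 1`. -/
abbrev Means (K : ℕ) : Type := Fin K → ℕ → ℝ

/-- `p` is the minimum period of the sequence `f`: the least positive integer `q` with
`f (t + q) = f t` for all `t`. -/
def IsMinPeriod (f : ℕ → ℝ) (p : ℕ) : Prop :=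
  IsLeast {q : ℕ | 0 < q ∧ ∀ t, f (t + q) = f t} p

/-- The class of bandit instances with mean rewards in `[0, 1]` in which every arm `k` is periodic
with minimum period `τ k`. -/
def periodicClass {K : ℕ} (τ : Fin K → ℕ) : Set (Means K) :=
  {μ | (∀ k t, μ k t ∈ Set.Icc (0 : ℝ) 1) ∧ ∀ k, IsMinPeriod (μ k) (τ k)}

/-- A history of `t` rounds: the arms pulled and the rewards observed. -/
abbrev History (K t : ℕ) : Type := Fin t → Fin K × ℝ

/-- An admissible (possibly randomized) policy: at every epoch `t` it chooses the probability
distribution of the next arm as a measurable function of the arms pulled and the rewards observed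
at the epochs before `t`. -/
structure Policy (K : ℕ) where
  /-- the conditional distribution of the arm pulled at epoch `t` given the history -/
  choice : (t : ℕ) → Kernel (History K t) (Fin K)
  /-- it is a probability distribution -/
  markov : ∀ t, IsMarkovKernel (choice t)

instance {K : ℕ} (π : Policy K) (t : ℕ) : IsMarkovKernel (π.choice t) := π.markov t

/-- The reward distribution at epoch `t`: given the arm `a`, the reward is Gaussian with mean
`μ a t` and variance `1`. -/
def rewardKernel {K : ℕ} (μ : Means K) (t : ℕ) : Kernel (Fin K) ℝ :=
  Kernel.ofFunOfCountable fun a => gaussianReal (μ a t) 1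

instance {K : ℕ} (μ : Means K) (t : ℕ) : IsMarkovKernel (rewardKernel μ t) :=
  ⟨fun a => by
    change IsProbabilityMeasure (gaussianReal (μ a t) 1)
    infer_instance⟩

/-- The joint law of the arm pulled and the reward received at epoch `t`, given the history. The
reward depends on the history only through the arm pulled. -/
def stepKernel {K : ℕ} (π : Policy K) (μ : Means K) (t : ℕ) :
    Kernel (History K t) (Fin K × ℝ) :=
  π.choice t ⊗ₖ Kernel.prodMkLeft (History K t) (rewardKernel μ t)

instance {K : ℕ} (π : Policy K) (μ : Means K) (t : ℕ) : IsMarkovKernel (stepKernel π μ t) := by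
  unfold stepKernel
  infer_instance

/-- Appending the arm and the reward of epoch `t` to the history of the epochs before `t`. -/
def appendRound {K t : ℕ} (x : History K t × (Fin K × ℝ)) : History K (t + 1) :=
  Fin.snoc (α := fun _ => Fin K × ℝ) x.1 x.2

theorem measurable_appendRound {K t : ℕ} :
    Measurable (appendRound : History K t × (Fin K × ℝ) → History K (t + 1)) := by
  refine measurable_pi_lambda _ fun i => ?_
  refine Fin.lastCases ?_ (fun j => ?_) i
  · simpa [appendRound] using measurable_snd
  · simp only [appendRound, Fin.snoc_castSucc]
    exact (measurable_pi_apply j).comp measurable_fst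

/-- The law of the history of the first `t` epochs when the policy `π` interacts with the bandit
instance `μ`. -/
def historyLaw {K : ℕ} (π : Policy K) (μ : Means K) : (t : ℕ) → Measure (History K t)
  | 0 => Measure.dirac Fin.elim0
  | t + 1 => ((historyLaw π μ t) ⊗ₘ (stepKernel π μ t)).map appendRound

instance isProbabilityMeasure_historyLaw {K : ℕ} (π : Policy K) (μ : Means K) (t : ℕ) :
    IsProbabilityMeasure (historyLaw π μ t) := by
  induction t with
  | zero => unfold historyLaw; infer_instance
  | succ t ih =>
    unfold historyLaw
    exact Measure.isProbabilityMeasure_map measurable_appendRound.aemeasurable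

/-- The pseudo-regret of a history of `T` epochs: the sum over the epochs `t < T` of the gap
between the largest mean reward at epoch `t` and the mean reward of the arm pulled. -/
def pseudoRegret {K : ℕ} (μ : Means K) {T : ℕ} (h : History K T) : ℝ :=
  ∑ t : Fin T, ((⨆ k, μ k t) - μ (h t).1 t)

/-- The expected regret of the policy `π` over `T` epochs on the bandit instance `μ`. -/
def expectedRegret {K : ℕ} (π : Policy K) (μ : Means K) (T : ℕ) : ℝ :=
  ∫ h, pseudoRegret μ h ∂(historyLaw π μ T)

/-- The worst-case expected regret of the policy `π` over `T` epochs, i.e. the supremum of its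
expected regret over all bandit instances whose arms have minimum periods `τ`. -/
def worstCaseRegret {K : ℕ} (π : Policy K) (τ : Fin K → ℕ) (T : ℕ) : ℝ :=
  ⨆ μ : periodicClass τ, expectedRegret π μ.1 T

end PeriodicBandit

end

open MeasureTheory ProbabilityTheory

namespace PeriodicBandit

/-! One arm `k₀` of period `p` already forces the bound. In each of its `p` phases its mean sits
about `Δ` above or below the others, as coded by a set `S` of phases. Flipping one phase changes the
means at no more than `T / p + 1` epochs below `T`, so for `Δ` of order `√(p / T)` the two history
laws stay close. By `half_le_real_compl_add_real`, at an epoch of the flipped phase the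
probabilities of a wrong arm under `S` and under its flip add up to at least `1 / 2`. Averaging over
all `S` makes every epoch cost at least `Δ / 8` (`gap_mul_horizon_le_worstCaseRegret`), hence a
total of order `√(T p)`. Taking `k₀` of largest period concludes. -/

/-! ### Change of measure -/

theorem sq_lintegral_mul_le {α : Type*} [MeasurableSpace α] (m : Measure α)
    {f g : α → ENNReal} (hf : Measurable f) (hg : Measurable g) :
    (∫⁻ x, f x * g x ∂m) ^ 2 ≤ (∫⁻ x, f x ^ 2 ∂m) * ∫⁻ x, g x ^ 2 ∂m := by
  have h := ENNReal.lintegral_mul_le_Lp_mul_Lq m Real.HolderConjugate.two_two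
    hf.aemeasurable hg.aemeasurable
  have hsq (a : ENNReal) : (a ^ (1 / 2 : ℝ)) ^ 2 = a := by
    rw [← ENNReal.rpow_natCast, ← ENNReal.rpow_mul]; norm_num
  have h2 := pow_le_pow_left₀ (zero_le) h 2
  rw [mul_pow, hsq, hsq] at h2
  simpa using h2

theorem sq_lintegral_le {α : Type*} [MeasurableSpace α] (m : Measure α) [IsProbabilityMeasure m]
    {f : α → ENNReal} (hf : Measurable f) :
    (∫⁻ x, f x ∂m) ^ 2 ≤ ∫⁻ x, f x ^ 2 ∂m := by
  simpa using sq_lintegral_mul_le m hf (measurable_const (a := (1 : ENNReal)))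

/-- A change of mean for unit-variance Gaussians: the chi-square divergence bounds the
integral under one mean by the second moment under the other. -/
theorem sq_lintegral_gaussianReal_le (a b : ℝ) {f : ℝ → ENNReal} (hf : Measurable f) :
    (∫⁻ x, f x ∂gaussianReal a 1) ^ 2 ≤
      ENNReal.ofReal (Real.exp ((a - b) ^ 2)) * ∫⁻ x, f x ^ 2 ∂gaussianReal b 1 := by
  -- The likelihood ratio of `N(a, 1)` to `N(b, 1)`.
  let r : ℝ → ENNReal := fun x => ENNReal.ofReal (Real.exp ((a - b) * (x - b) - (a - b) ^ 2 / 2))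
  have hr : Measurable r := by fun_prop
  have hpdf (c : ℝ) {g : ℝ → ENNReal} (hg : Measurable g) :
      ∫⁻ x, g x ∂gaussianReal c 1 = ∫⁻ x, gaussianPDF c 1 x * g x := by
    rw [gaussianReal_of_var_ne_zero c one_ne_zero,
      lintegral_withDensity_eq_lintegral_mul _ (measurable_gaussianPDF c 1) hg]
    rfl
  have h1 (x : ℝ) : gaussianPDF b 1 x * r x = gaussianPDF a 1 x := by
    simp only [gaussianPDF, gaussianPDFReal, r]
    rw [← ENNReal.ofReal_mul (by positivity), mul_assoc, ← Real.exp_add]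
    congr 3
    push_cast
    ring
  -- Completing the square: the second moment of `r` is the total mass of a shifted Gaussian times a
  -- constant.
  have h2 (x : ℝ) : gaussianPDF b 1 x * r x ^ 2 =
      ENNReal.ofReal (Real.exp ((a - b) ^ 2)) * gaussianPDF (b + 2 * (a - b)) 1 x := by
    simp only [gaussianPDF, gaussianPDFReal, r]
    rw [← ENNReal.ofReal_pow (by positivity), ← ENNReal.ofReal_mul (by positivity),
      ← ENNReal.ofReal_mul (by positivity), ← Real.exp_nat_mul, mul_assoc, ← Real.exp_add,
      mul_left_comm, ← Real.exp_add]
    congr 3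
    push_cast
    ring
  have hfr : ∫⁻ x, f x ∂gaussianReal a 1 = ∫⁻ x, f x * r x ∂gaussianReal b 1 := by
    rw [hpdf a hf, hpdf b (g := fun x => f x * r x) (hf.mul hr)]
    refine lintegral_congr fun x => ?_
    rw [← h1]
    ring
  have hrr : ∫⁻ x, r x ^ 2 ∂gaussianReal b 1 = ENNReal.ofReal (Real.exp ((a - b) ^ 2)) := by
    rw [hpdf b (hr.pow_const 2)]
    simp_rw [h2]
    rw [lintegral_const_mul _ (measurable_gaussianPDF _ 1),
      lintegral_gaussianPDF_eq_one _ one_ne_zero, mul_one]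
  rw [hfr, ← hrr, mul_comm (∫⁻ x, r x ^ 2 ∂gaussianReal b 1)]
  exact sq_lintegral_mul_le _ hf hr

theorem lintegral_stepKernel {K : ℕ} (π : Policy K) (μ : Means K) (t : ℕ) (h : History K t)
    {f : Fin K × ℝ → ENNReal} (hf : Measurable f) :
    ∫⁻ y, f y ∂stepKernel π μ t h =
      ∫⁻ a, ∫⁻ x, f (a, x) ∂gaussianReal (μ a t) 1 ∂π.choice t h := by
  rw [stepKernel, Kernel.lintegral_compProd _ _ _ hf]
  rfl

theorem lintegral_historyLaw_succ {K : ℕ} (π : Policy K) (μ : Means K) (t : ℕ)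
    {f : History K (t + 1) → ENNReal} (hf : Measurable f) :
    ∫⁻ h, f h ∂historyLaw π μ (t + 1) =
      ∫⁻ h, ∫⁻ y, f (appendRound (h, y)) ∂stepKernel π μ t h ∂historyLaw π μ t := by
  rw [historyLaw, lintegral_map hf measurable_appendRound,
    Measure.lintegral_compProd (f := fun x => f (appendRound x))
      (hf.comp measurable_appendRound)]

/-- The change-of-instance inequality for history laws. -/
theorem sq_lintegral_historyLaw_le {K : ℕ} (π : Policy K) (μ ν : Means K) (d : ℕ → ℝ)
    (hd : ∀ k s, |μ k s - ν k s| ≤ d s) (t : ℕ) {f : History K t → ENNReal} (hf : Measurable f) :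
    (∫⁻ h, f h ∂historyLaw π μ t) ^ 2 ≤
      ENNReal.ofReal (Real.exp (∑ s ∈ Finset.range t, d s ^ 2)) *
        ∫⁻ h, f h ^ 2 ∂historyLaw π ν t := by
  induction t with
  | zero => simp [historyLaw, lintegral_dirac' _ hf, lintegral_dirac' _ (hf.pow_const 2)]
  | succ t ih =>
    have hF : Measurable fun x : History K t × (Fin K × ℝ) => f (appendRound x) :=
      hf.comp measurable_appendRound
    have hF2 : Measurable fun x : History K t × (Fin K × ℝ) => f (appendRound x) ^ 2 :=
      hF.pow_const 2
    have hstep (h : History K t) :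
        (∫⁻ y, f (appendRound (h, y)) ∂stepKernel π μ t h) ^ 2 ≤
          ENNReal.ofReal (Real.exp (d t ^ 2)) *
            ∫⁻ y, f (appendRound (h, y)) ^ 2 ∂stepKernel π ν t h := by
      have hh : Measurable fun y : Fin K × ℝ => f (appendRound (h, y)) :=
        hF.comp measurable_prodMk_left
      rw [lintegral_stepKernel π μ t h hh, lintegral_stepKernel π ν t h (hh.pow_const 2)]
      -- The arm has the same law under both instances, so Jensen suffices for it; only the reward
      -- pays an exponential factor.
      refine (sq_lintegral_le _ (measurable_of_countable _)).trans ?_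
      rw [← lintegral_const_mul _ (measurable_of_countable _)]
      refine lintegral_mono fun a => ?_
      refine (sq_lintegral_gaussianReal_le (μ a t) (ν a t)
        (hh.comp measurable_prodMk_left)).trans ?_
      gcongr ENNReal.ofReal (Real.exp ?_) * _
      exact sq_le_sq.2 ((hd a t).trans (le_abs_self _))
    rw [lintegral_historyLaw_succ π μ t hf, lintegral_historyLaw_succ π ν t (hf.pow_const 2)]
    have hm : Measurable fun h => ∫⁻ y, f (appendRound (h, y)) ∂stepKernel π μ t h :=
      hF.lintegral_kernel_prod_right'
    have hm2 : Measurable fun h => ∫⁻ y, f (appendRound (h, y)) ^ 2 ∂stepKernel π ν t h :=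
      hF2.lintegral_kernel_prod_right'
    refine (ih hm).trans ?_
    rw [Finset.sum_range_succ, Real.exp_add, ENNReal.ofReal_mul (Real.exp_pos _).le, mul_assoc,
      ← lintegral_const_mul _ hm2]
    gcongr with h
    exact hstep h

/-- No event is likely under one instance and unlikely under a close one. -/
theorem half_le_real_compl_add_real {K : ℕ} (π : Policy K) (μ ν : Means K) (d : ℕ → ℝ)
    (hd : ∀ k s, |μ k s - ν k s| ≤ d s) (t : ℕ)
    (hsum : ∑ s ∈ Finset.range t, d s ^ 2 ≤ 1 / 4) {A : Set (History K t)}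
    (hA : MeasurableSet A) :
    1 / 2 ≤ (historyLaw π μ t).real Aᶜ + (historyLaw π ν t).real A := by
  have h := sq_lintegral_historyLaw_le π μ ν d hd t
    (f := A.indicator 1) (measurable_one.indicator hA)
  have hi : (fun h : History K t => A.indicator (1 : History K t → ENNReal) h ^ 2) =
      A.indicator 1 := by
    ext h
    by_cases hh : h ∈ A <;> simp [hh]
  rw [hi, lintegral_indicator_one hA, lintegral_indicator_one hA] at h
  have h' := ENNReal.toReal_mono (by finiteness) h
  rw [ENNReal.toReal_pow, ENNReal.toReal_mul, ENNReal.toReal_ofReal (Real.exp_pos _).le] at h'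
  change (historyLaw π μ t).real A ^ 2 ≤ _ * (historyLaw π ν t).real A at h'
  have hexp : Real.exp (∑ s ∈ Finset.range t, d s ^ 2) ≤ 2 := by
    have h1 : Real.exp (1 / 4) ≤ 2 := by
      have := Real.exp_bound_div_one_sub_of_interval (x := 1 / 4) (by norm_num) (by norm_num)
      linarith
    exact (Real.exp_le_exp.2 hsum).trans h1
  rw [probReal_compl_eq_one_sub hA]
  have hy : 0 ≤ (historyLaw π ν t).real A := measureReal_nonneg
  -- From `x ^ 2 ≤ 2 * y` follows `1 - x + y ≥ 1 / 2 + (x - 1) ^ 2 / 2`.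
  nlinarith [sq_nonneg ((historyLaw π μ t).real A - 1), mul_le_mul_of_nonneg_right hexp hy]

/-! ### Regret as a sum over epochs -/

theorem measurableSet_of_arm {K T : ℕ} (t : Fin T) (s : Set (Fin K)) :
    MeasurableSet {h : History K T | (h t).1 ∈ s} :=
  (measurable_fst.comp (measurable_pi_apply t)) (MeasurableSet.of_discrete (s := s))

theorem measurable_pseudoRegret {K : ℕ} (μ : Means K) (T : ℕ) :
    Measurable (pseudoRegret μ : History K T → ℝ) := by
  refine Finset.measurable_fun_sum _ fun t _ => measurable_const.sub ?_
  exact (measurable_of_countable fun a => μ a t).comp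
    (measurable_fst.comp (measurable_pi_apply t))

theorem mean_le_iSup {K : ℕ} (μ : Means K) (k : Fin K) (t : ℕ) : μ k t ≤ ⨆ k, μ k t :=
  le_ciSup (Set.finite_range fun k => μ k t).bddAbove k

theorem abs_pseudoRegret_le {K : ℕ} {μ : Means K} (hμ : ∀ k t, μ k t ∈ Set.Icc (0 : ℝ) 1)
    {T : ℕ} (h : History K T) : |pseudoRegret μ h| ≤ T := by
  unfold pseudoRegret
  refine (Finset.abs_sum_le_sum_abs _ _).trans ?_
  have hb (t : Fin T) : |(⨆ k, μ k t) - μ (h t).1 t| ≤ 1 := by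
    have : Nonempty (Fin K) := ⟨(h t).1⟩
    have h1 := mean_le_iSup μ (h t).1 t
    have h2 : ⨆ k, μ k t ≤ 1 := ciSup_le fun k => (hμ k t).2
    have h3 := (hμ (h t).1 t).1
    rw [abs_le]
    constructor <;> linarith
  simpa using Finset.sum_le_sum fun t (_ : t ∈ Finset.univ) => hb t

/-- A real supremum says something only for a bounded family; here `T` bounds every regret. -/
theorem expectedRegret_le_worstCaseRegret {K : ℕ} (π : Policy K) {τ : Fin K → ℕ} {μ : Means K}
    (hμ : μ ∈ periodicClass τ) (T : ℕ) : expectedRegret π μ T ≤ worstCaseRegret π τ T := by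
  refine le_ciSup (f := fun ν : periodicClass τ => expectedRegret π ν.1 T) ⟨T, ?_⟩ ⟨μ, hμ⟩
  rintro _ ⟨ν, rfl⟩
  refine (le_abs_self _).trans ?_
  have := norm_integral_le_of_norm_le_const (μ := historyLaw π ν.1 T)
    (f := pseudoRegret ν.1) (C := T) (ae_of_all _ fun h => abs_pseudoRegret_le ν.2.1 h)
  simpa [expectedRegret] using this

/-- If at each epoch `t` choosing an arm in `B t` costs at least `c`, the expected regret is at
least `c` times the expected number of such choices. -/
theorem sum_le_expectedRegret {K : ℕ} (π : Policy K) {μ : Means K}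
    (hμ : ∀ k t, μ k t ∈ Set.Icc (0 : ℝ) 1) (T : ℕ) (c : ℝ) (B : ℕ → Set (Fin K))
    (hB : ∀ t, ∀ k ∈ B t, c ≤ (⨆ k, μ k t) - μ k t) :
    ∑ t : Fin T, c * (historyLaw π μ T).real {h | (h t).1 ∈ B t} ≤ expectedRegret π μ T := by
  have hmeas (t : Fin T) := measurableSet_of_arm (K := K) t (B t)
  have hint (t : Fin T) : Integrable
      ({h : History K T | (h t).1 ∈ B t}.indicator fun _ => c) (historyLaw π μ T) :=
    (integrable_const c).indicator (hmeas t)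
  have hsum : ∑ t : Fin T, c * (historyLaw π μ T).real {h | (h t).1 ∈ B t} =
      ∫ h, ∑ t : Fin T, {h : History K T | (h t).1 ∈ B t}.indicator (fun _ => c) h
        ∂historyLaw π μ T := by
    rw [integral_finsetSum _ fun t _ => hint t]
    refine Finset.sum_congr rfl fun t _ => ?_
    rw [integral_indicator_const c (hmeas t), smul_eq_mul, mul_comm]
  rw [hsum, expectedRegret]
  refine integral_mono (integrable_finsetSum _ fun t _ => hint t) ?_ fun h => ?_
  · exact Integrable.of_bound (measurable_pseudoRegret μ T).aestronglyMeasurable T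
      (ae_of_all _ fun h => abs_pseudoRegret_le hμ h)
  · refine Finset.sum_le_sum fun t _ => ?_
    refine Set.indicator_apply_le' (fun ht => hB t _ ht) fun _ => ?_
    exact sub_nonneg.2 (mean_le_iSup μ (h t).1 t)

/-! ### The hard instances -/

/-- The hard instances: arm `k₀` is better than the others by about `Δ` in the phases belonging to
`S` and worse by about `Δ` in the other phases. The bump of height `Δ / 2` at the multiples of
the period makes the minimum periods exact. -/
noncomputable def hardMeans {K : ℕ} (τ : Fin K → ℕ) (k₀ : Fin K) (Δ : ℝ) (S : Finset ℕ) :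
    Means K :=
  fun k s => 1 / 2 + (if τ k ∣ s then Δ / 2 else 0) +
    if k = k₀ then (if s % τ k ∈ S then Δ else -Δ) else 0

theorem hardMeans_mem_periodicClass {K : ℕ} {τ : Fin K → ℕ} (hτ : ∀ k, 1 ≤ τ k) (k₀ : Fin K)
    {Δ : ℝ} (h0 : 0 < Δ) (h1 : Δ ≤ 1 / 4) (S : Finset ℕ) :
    hardMeans τ k₀ Δ S ∈ periodicClass τ := by
  refine ⟨fun k t => ?_, fun k => ⟨⟨hτ k, fun t => ?_⟩, fun q hq => ?_⟩⟩
  · unfold hardMeans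
    constructor <;> split_ifs <;> linarith
  · simp [hardMeans]
  · have h := hq.2 0
    -- Below `τ k`, epoch `q` lacks the bump present at epoch `0`; the resulting `Δ / 2` cannot be
    -- cancelled by a change of `0` or `±2Δ`.
    by_contra hlt
    have hnd : ¬ τ k ∣ q := fun hd => hlt (Nat.le_of_dvd hq.1 hd)
    simp only [hardMeans, zero_add, hnd, if_false, dvd_zero, if_true] at h
    split_ifs at h <;> linarith

open scoped symmDiff

/-- The phases in which the arm `k` is the wrong choice on the instance `hardMeans τ k₀ Δ S`. -/
def wrongArms {K : ℕ} (τ : Fin K → ℕ) (k₀ : Fin K) (S : Finset ℕ) (t : ℕ) : Set (Fin K) :=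
  {k | k = k₀ ↔ t % τ k₀ ∉ S}

theorem wrongArms_symmDiff {K : ℕ} (τ : Fin K → ℕ) (k₀ : Fin K) (S : Finset ℕ) (t : ℕ) :
    wrongArms τ k₀ (S ∆ {t % τ k₀}) t = (wrongArms τ k₀ S t)ᶜ := by
  ext k
  simp only [wrongArms, Set.mem_ofPred_eq, Set.mem_compl_iff, Finset.mem_symmDiff,
    Finset.mem_singleton]
  tauto

/-- A bump on the inferior arm alone can offset at most half of the advantage `Δ`. -/
theorem hardMeans_gap {K : ℕ} (hK : 2 ≤ K) (τ : Fin K → ℕ) (k₀ : Fin K) {Δ : ℝ} (h0 : 0 < Δ)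
    (S : Finset ℕ) (t : ℕ) (k : Fin K) (hk : k ∈ wrongArms τ k₀ S t) :
    Δ / 2 ≤ (⨆ k, hardMeans τ k₀ Δ S k t) - hardMeans τ k₀ Δ S k t := by
  by_cases hS : t % τ k₀ ∈ S
  · have hne : k ≠ k₀ := fun h => hk.1 h hS
    have h1 := mean_le_iSup (hardMeans τ k₀ Δ S) k₀ t
    have h2 : 1 / 2 + Δ ≤ hardMeans τ k₀ Δ S k₀ t := by
      simp only [hardMeans, hS, if_true]
      split_ifs <;> linarith
    have h3 : hardMeans τ k₀ Δ S k t ≤ 1 / 2 + Δ / 2 := by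
      simp only [hardMeans, hne, if_false]
      split_ifs <;> linarith
    linarith
  · obtain rfl : k = k₀ := hk.2 hS
    have : Nontrivial (Fin K) := Fin.nontrivial_iff_two_le.2 hK
    obtain ⟨j, hj⟩ := exists_ne k
    have h1 := mean_le_iSup (hardMeans τ k Δ S) j t
    have h2 : 1 / 2 ≤ hardMeans τ k Δ S j t := by
      simp only [hardMeans, hj, if_false]
      split_ifs <;> linarith
    have h3 : hardMeans τ k Δ S k t ≤ 1 / 2 - Δ / 2 := by
      simp only [hardMeans, hS, if_true, if_false]
      split_ifs <;> linarith
    linarith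

theorem abs_hardMeans_symmDiff_sub_le {K : ℕ} (τ : Fin K → ℕ) (k₀ : Fin K) {Δ : ℝ} (h0 : 0 < Δ)
    (S : Finset ℕ) (r : ℕ) (k : Fin K) (s : ℕ) :
    |hardMeans τ k₀ Δ (S ∆ {r}) k s - hardMeans τ k₀ Δ S k s| ≤
      if s % τ k₀ = r then 2 * Δ else 0 := by
  simp only [hardMeans, Finset.mem_symmDiff, Finset.mem_singleton, add_sub_add_left_eq_sub]
  by_cases hk : k = k₀
  · subst hk
    by_cases hr : s % τ k = r <;> by_cases hS : s % τ k ∈ S <;> rw [abs_le] <;>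
      simp only [hr, hS, if_true, if_false, not_true, not_false_eq_true, and_true, and_false,
        or_false, true_and, or_self] <;>
      (try simp_all) <;> (try constructor) <;> linarith
  · simp only [hk, if_false, sub_zero, abs_zero]
    split_ifs <;> linarith

/-- A residue class mod `p` meets the horizon at most `T / p + 1` times, each time contributing `4 *
Δ ^ 2`. -/
theorem sum_sq_ite_mod_le {p T r : ℕ} (hp : 0 < p) {Δ : ℝ}
    (hΔ : Δ ^ 2 * ((T / p : ℕ) + 1) ≤ 1 / 16) :
    ∑ s ∈ Finset.range T, (if s % p = r % p then 2 * Δ else 0) ^ 2 ≤ 1 / 4 := by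
  have hc : (((Finset.range T).filter fun s => s % p = r % p).card : ℝ) ≤ (T / p : ℕ) + 1 := by
    have h := Nat.count_modEq_card T hp r
    rw [Nat.count_eq_card_filter_range] at h
    change ((Finset.range T).filter fun s => s % p = r % p).card = _ at h
    have : ((Finset.range T).filter fun s => s % p = r % p).card ≤ T / p + 1 := by
      rw [h]
      split_ifs <;> omega
    exact_mod_cast this
  have he : ∑ s ∈ Finset.range T, (if s % p = r % p then 2 * Δ else 0) ^ 2 =
      ((Finset.range T).filter fun s => s % p = r % p).card * (2 * Δ) ^ 2 := by
    simp only [ite_pow, zero_pow two_ne_zero, ← Finset.sum_filter, Finset.sum_const, nsmul_eq_mul]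
  rw [he]
  nlinarith [mul_le_mul_of_nonneg_right hc (sq_nonneg (2 * Δ))]

theorem sum_powerset_symmDiff {p r : ℕ} (hr : r < p) (f : Finset ℕ → ℝ) :
    ∑ S ∈ (Finset.range p).powerset, f (S ∆ {r}) = ∑ S ∈ (Finset.range p).powerset, f S := by
  have hmem (S : Finset ℕ) (hS : S ∈ (Finset.range p).powerset) :
      S ∆ {r} ∈ (Finset.range p).powerset := by
    rw [Finset.mem_powerset] at hS ⊢
    intro x hx
    rcases Finset.mem_symmDiff.1 hx with ⟨h, -⟩ | ⟨h, -⟩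
    · exact hS h
    · rw [Finset.mem_singleton] at h
      simpa [h] using hr
  exact Finset.sum_nbij' (· ∆ {r}) (· ∆ {r}) hmem hmem (by simp) (by simp) (by simp)

/-! ### Averaging over the hard instances -/

theorem gap_mul_horizon_le_worstCaseRegret {K T : ℕ} (hK : 2 ≤ K) {τ : Fin K → ℕ}
    (hτ : ∀ k, 1 ≤ τ k) (π : Policy K) (k₀ : Fin K) {Δ : ℝ} (h0 : 0 < Δ) (h1 : Δ ≤ 1 / 4)
    (hΔ : Δ ^ 2 * ((T / τ k₀ : ℕ) + 1) ≤ 1 / 16) :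
    Δ * T / 8 ≤ worstCaseRegret π τ T := by
  set P := (Finset.range (τ k₀)).powerset with hP
  let w (S : Finset ℕ) (t : Fin T) : ℝ :=
    (historyLaw π (hardMeans τ k₀ Δ S) T).real {h | (h t).1 ∈ wrongArms τ k₀ S t}
  have hpair (S : Finset ℕ) (t : Fin T) : 1 / 2 ≤ w (S ∆ {t % τ k₀}) t + w S t := by
    have h := half_le_real_compl_add_real π (hardMeans τ k₀ Δ (S ∆ {t % τ k₀}))
      (hardMeans τ k₀ Δ S) _ (abs_hardMeans_symmDiff_sub_le τ k₀ h0 S (t % τ k₀)) T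
      (sum_sq_ite_mod_le (hτ k₀) hΔ) (measurableSet_of_arm t (wrongArms τ k₀ S t))
    simp only [w, wrongArms_symmDiff]
    exact h
  -- Flipping the phase of `t` permutes the family, so summing `hpair` counts each `w S t` twice.
  have hepoch (t : Fin T) : (P.card : ℝ) / 4 ≤ ∑ S ∈ P, w S t := by
    have h := Finset.sum_le_sum fun S (_ : S ∈ P) => hpair S t
    rw [Finset.sum_add_distrib,
      sum_powerset_symmDiff (Nat.mod_lt _ (hτ k₀)) fun S => w S t, Finset.sum_const,
      nsmul_eq_mul] at h
    linarith
  have hreg (S : Finset ℕ) : ∑ t : Fin T, Δ / 2 * w S t ≤ worstCaseRegret π τ T := by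
    have hmem := hardMeans_mem_periodicClass hτ k₀ h0 h1 S
    exact (sum_le_expectedRegret π hmem.1 T _ _ (hardMeans_gap hK τ k₀ h0 S)).trans
      (expectedRegret_le_worstCaseRegret π hmem T)
  have hcard : 0 < (P.card : ℝ) := by
    exact_mod_cast Finset.card_pos.2 ⟨∅, Finset.empty_mem_powerset _⟩
  have htot : (P.card : ℝ) * (Δ * T / 8) ≤ P.card * worstCaseRegret π τ T := by
    calc (P.card : ℝ) * (Δ * T / 8) = ∑ _t : Fin T, Δ / 2 * ((P.card : ℝ) / 4) := by
          simp; ring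
      _ ≤ ∑ t : Fin T, Δ / 2 * ∑ S ∈ P, w S t := by
          gcongr with t
          exact hepoch t
      _ = ∑ S ∈ P, ∑ t : Fin T, Δ / 2 * w S t := by
          simp_rw [Finset.mul_sum]
          exact Finset.sum_comm
      _ ≤ ∑ _S ∈ P, worstCaseRegret π τ T := Finset.sum_le_sum fun S _ => hreg S
      _ = _ := by simp
  exact le_of_mul_le_mul_left htot hcard

/-- The lower bound through the period of a single arm. -/
theorem sqrt_horizon_mul_period_le_worstCaseRegret {K T : ℕ} (hK : 2 ≤ K) {τ : Fin K → ℕ}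
    (hτ : ∀ k, 1 ≤ τ k) (π : Policy K) (k₀ : Fin K) (hT : τ k₀ ≤ T) :
    1 / (32 * Real.exp 1) * Real.sqrt (T * τ k₀) ≤ worstCaseRegret π τ T := by
  set n : ℝ := ((T / τ k₀ : ℕ) : ℝ) + 1 with hn
  have hp : (1 : ℝ) ≤ τ k₀ := by exact_mod_cast hτ k₀
  have hn1 : 1 ≤ n := by simp [hn]
  have hs1 : 1 ≤ Real.sqrt n := Real.one_le_sqrt.2 hn1
  have hnT : n * τ k₀ ≤ 2 * T := by
    have h := Nat.div_mul_le_self T (τ k₀)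
    have h' : (T / τ k₀ + 1) * τ k₀ ≤ 2 * T := by
      rw [add_mul]
      omega
    rw [hn]
    exact_mod_cast h'
  have hsq : Real.sqrt n ^ 2 = n := Real.sq_sqrt (by linarith)
  -- This `Δ` makes `Δ ^ 2 * n = 1 / 16`, the largest value allowed.
  refine le_trans ?_ (gap_mul_horizon_le_worstCaseRegret (T := T) hK hτ π k₀
    (Δ := 1 / (4 * Real.sqrt n)) (by positivity) ?_ ?_)
  · have h2 : Real.sqrt (T * τ k₀) * Real.sqrt n ≤ Real.exp 1 * T := by
      rw [← Real.sqrt_mul (by positivity)]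
      refine Real.sqrt_le_iff.2 ⟨by positivity, ?_⟩
      -- The factor `e` is slack: `√2` would do, since `n * τ k₀ ≤ 2 * T`.
      have he : 2 ≤ Real.exp 1 := by linarith [Real.add_one_le_exp (1 : ℝ)]
      calc (T : ℝ) * τ k₀ * n = T * (n * τ k₀) := by ring
        _ ≤ T * (2 * T) := by gcongr
        _ ≤ (2 * T) ^ 2 := by nlinarith [sq_nonneg (T : ℝ)]
        _ ≤ (Real.exp 1 * T) ^ 2 := by gcongr
    have hx : 1 / (4 * Real.sqrt n) * T / 8 = T / (32 * Real.sqrt n) := by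
      field_simp
      ring
    rw [hx, one_div_mul_eq_div, div_le_div_iff₀ (by positivity) (by positivity)]
    linarith
  · rw [div_le_div_iff₀ (by positivity) (by norm_num)]
    linarith
  · rw [← hn, div_pow, mul_pow, hsq]
    apply le_of_eq
    field_simp
    norm_num

end PeriodicBandit

theorem theorem3 (K T : ℕ) (hK : 2 ≤ K) (τ : Fin K → ℕ) (hτ : ∀ k, 1 ≤ τ k)
    (hT : ∀ k, τ k ≤ T) (π : PeriodicBandit.Policy K) :
    1 / (32 * Real.exp 1) * Real.sqrt ((T : ℝ) * (Finset.univ.sup τ : ℕ))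
        ≤ PeriodicBandit.worstCaseRegret π τ T ∧
      1 / (32 * Real.exp 1) * (Real.sqrt ((T : ℝ) * ∑ k, (τ k : ℝ)) / Real.sqrt K)
        ≤ PeriodicBandit.worstCaseRegret π τ T := by
  have hne : (Finset.univ : Finset (Fin K)).Nonempty := ⟨⟨0, by omega⟩, Finset.mem_univ _⟩
  obtain ⟨k₀, -, hk₀⟩ := Finset.exists_mem_eq_sup Finset.univ hne τ
  have h := PeriodicBandit.sqrt_horizon_mul_period_le_worstCaseRegret hK hτ π k₀ (hT k₀)
  rw [hk₀]
  refine ⟨h, le_trans ?_ h⟩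
  gcongr
  have hK0 : (0 : ℝ) < K := by
    have : 0 < K := by omega
    exact_mod_cast this
  rw [div_le_iff₀ (Real.sqrt_pos.2 hK0), ← Real.sqrt_mul (by positivity)]
  refine Real.sqrt_le_sqrt ?_
  have hsum : ∑ k, (τ k : ℝ) ≤ K * τ k₀ := by
    have : ∀ k ∈ Finset.univ, (τ k : ℝ) ≤ τ k₀ := fun k hk => by
      rw [← hk₀]
      exact_mod_cast Finset.le_sup (f := τ) hk
    simpa using Finset.sum_le_card_nsmul _ _ _ this
  calc (T : ℝ) * ∑ k, (τ k : ℝ) ≤ T * (K * τ k₀) := by gcongr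
    _ = T * τ k₀ * K := by ring
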